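/- All spaces are over the real scalars. For a Banach space $E$ let $\mathcal S(E)$ denote the set of all separable closed linear subspaces of $E$, ordered by inclusion. A subset $\mathcal R\subset\mathcal S(E)$ is called rich in $E$ if it is cofinal (every element of $\mathcal S(E)$ is contained in some element of $\mathcal R$) and $\sigma$-complete (every increasing sequence $R_1\subset R_2\subset\cdots$ of elements of $\mathcal R$ has a supremum in $\mathcal S(E)$, and this supremum belongs to $\mathcal R$). A block-family in $E_1\times E_2\times E_3$ is a set of products $U\times V\times Y$ with $U\in\mathcal S(E_1)$, $V\in\mathcal S(E_2)$, $Y\in\mathcal S(E_3)$. A Banach space is called Asplund if every convex continuous real-valued function on it is Fréchet differentiable at some point. **Theorem 2.5.** Let $(Z,\|\cdot\|)$ be a Banach space, $(X,\|\cdot\|)$ an Asplund space, $T:Z\to X$ a bounded linear operator, and let $z^*\in Z^*$ be given. Then there exists a rich block-family $\mathcal A_T$ in $Z\times X\times X^*$ such that: 1. $Y_1\subset Y_2$ whenever $U_1\times V_1\times Y_1,\ U_2\times V_2\times Y_2\in\mathcal A_T$ and $V_1\subset V_2$; 2. for every $U\times V\times Y\in\mathcal A_T$ we have $T(U)\subset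 V$, the restriction assignment $Y\ni x^*\mapsto x^*|_V\in V^*$ is a surjective isometry, and $$\|T^*x^*-z^*\|=\big\|(T|_U)^*(x^*|_V)-z^*|_U\big\|\qquad\text{for every }x^*\in Y,$$ where $T|_U$ is regarded as an operator from $U$ to $V$. -/

import Mathlib

/-- A real normed space is *Asplund* if every convex continuous function on it is
Fréchet differentiable at some point. (Only used for complete `X`.) -/
def IsAsplund (X : Type*) [NormedAddCommGroup X] [NormedSpace ℝ X] : Prop :=
  ∀ f : X → ℝ, ConvexOn ℝ Set.univ f → Continuous f → ∃ x, DifferentiableAt ℝ f x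

/-- A subset `R` of a poset `P` is cofinal if every element of `P` lies below some element
of `R`. -/
def IsCofinalFamily {P : Type*} [PartialOrder P] (R : Set P) : Prop :=
  ∀ t : P, ∃ r ∈ R, t ≤ r

/-- A subset `R` of a poset `P` is `σ`-complete if every increasing sequence in `R` has a
supremum in `P`, and this supremum belongs to `R`. -/
def IsSigmaComplete {P : Type*} [PartialOrder P] (R : Set P) : Prop :=
  ∀ r : ℕ → P, Monotone r → (∀ n, r n ∈ R) → ∃ s ∈ R, IsLUB (Set.range r) s

/-- Rich (club) subsets of a poset. -/
def IsRich {P : Type*} [PartialOrder P] (R : Set P) : Prop :=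
  IsCofinalFamily R ∧ IsSigmaComplete R

/-- The family `𝒮(E)` of all separable closed linear subspaces of `E`, ordered by inclusion. -/
abbrev SepSubspace (E : Type*) [NormedAddCommGroup E] [NormedSpace ℝ E] : Type _ :=
  {W : Submodule ℝ E // IsClosed (W : Set E) ∧ TopologicalSpace.IsSeparable (W : Set E)}

namespace SepSubspace

variable {E₁ E₂ E₃ : Type*}
  [NormedAddCommGroup E₁] [NormedSpace ℝ E₁]
  [NormedAddCommGroup E₂] [NormedSpace ℝ E₂]
  [NormedAddCommGroup E₃] [NormedSpace ℝ E₃]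

/-- The block `U × V × Y`, as a separable closed subspace of the product `E₁ × E₂ × E₃`. -/
noncomputable def block (U : SepSubspace E₁) (V : SepSubspace E₂) (Y : SepSubspace E₃) :
    SepSubspace (E₁ × E₂ × E₃) :=
  ⟨U.1.prod (V.1.prod Y.1),
    by
      simpa only [Submodule.prod_coe] using U.2.1.prod (V.2.1.prod Y.2.1),
    by
      simpa only [Submodule.prod_coe] using U.2.2.prod (V.2.2.prod Y.2.2)⟩

/-- A block-family in `E₁ × E₂ × E₃`: all its members are blocks. -/
def IsBlockFamily (𝒜 : Set (SepSubspace (E₁ × E₂ × E₃))) : Prop :=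
  ∀ W ∈ 𝒜, ∃ (U : SepSubspace E₁) (V : SepSubspace E₂) (Y : SepSubspace E₃), W = block U V Y

end SepSubspace

section Operators

variable {Z X : Type*} [NormedAddCommGroup Z] [NormedSpace ℝ Z]
  [NormedAddCommGroup X] [NormedSpace ℝ X]

/-- The adjoint `T* : X* → Z*`, `x* ↦ x* ∘ T`. -/
noncomputable def adjointOp (T : Z →L[ℝ] X) (x' : StrongDual ℝ X) : StrongDual ℝ Z :=
  x'.comp T

/-- The restriction `x*|_V ∈ V*` of a functional to a subspace. -/
noncomputable def restrictFunctional (V : Submodule ℝ X) (x' : StrongDual ℝ X) : StrongDual ℝ V :=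
  x'.comp V.subtypeL

end Operators

/-! Everything rests on an assignment `V ↦ Y V` of closed subspaces of `X*`
(`IsAsplund.exists_dual_assignment`): it is monotone, compatible with closures of increasing unions,
and for separable `V` has separable values whose restrictions are dense in `V*`. The family consists
of the blocks `U × V × Y V` satisfying `Reduces`. Assertion 1 is then monotonicity of `Y`, and a
norm-preserving restriction with dense range on the complete space `Y V` is onto. The conditions in
`Reduces` survive closures of increasing unions, whence σ-completeness; an ω-step saturation gives
cofinality.

To build `Y`, note that a Fréchet differentiability point of a support function yields a small weak*
slice. Removing slices transfinitely covers the dual ball by weak* open half-spaces, and functionals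
first met at one stage are `ε`-close to one centre. The weak* compact set `prescribedBall p` depends
upper semicontinuously on `p`, so being covered by stage `i` is an open condition on `p`; the least
such `i` supplies a centre near an element of that set. As `ℕ → X × ℝ` is metrizable, this choice
can be absorbed in a countable-valued map with open fibres (`exists_countable_selector`). Each value
then persists at nearby sequences, so a dense set of sequences yields all values. `Y V` is the
closed span of the values at sequences in `V`. -/

open Filter Topology

/-! ### Small weak* slices from Fréchet differentiability. -/

/-- In the dual of an Asplund space, every nonempty bounded set has a nonempty weak* slice
contained in a small ball. -/
theorem IsAsplund.exists_small_slice {X : Type*} [NormedAddCommGroup X] [NormedSpace ℝ X]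
    (hX : IsAsplund X) {A : Set (StrongDual ℝ X)} (hne : A.Nonempty) {r : ℝ}
    (hA : ∀ a ∈ A, ‖a‖ ≤ r) {ε : ℝ} (hε : 0 < ε) :
    ∃ (x : X) (c : ℝ) (L : StrongDual ℝ X), (∃ a ∈ A, c < a x) ∧
      ∀ a ∈ A, c < a x → ‖a - L‖ ≤ ε := by
  obtain ⟨a₀, ha₀⟩ := hne
  have hr : 0 ≤ r := (norm_nonneg a₀).trans (hA a₀ ha₀)
  have : Nonempty A := ⟨⟨a₀, ha₀⟩⟩
  have hbound : ∀ a ∈ A, ∀ x, a x ≤ r * ‖x‖ := fun a ha x =>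
    (le_abs_self _).trans ((a.le_opNorm x).trans
      (mul_le_mul_of_nonneg_right (hA a ha) (norm_nonneg x)))
  have hbdd : ∀ x, BddAbove (Set.range fun a : A => (a : StrongDual ℝ X) x) := fun x =>
    ⟨r * ‖x‖, by rintro _ ⟨a, rfl⟩; exact hbound a a.2 x⟩
  set p : X → ℝ := fun x => ⨆ a : A, (a : StrongDual ℝ X) x with hp
  have hle : ∀ a ∈ A, ∀ x, a x ≤ p x := fun a ha x => le_ciSup (hbdd x) ⟨a, ha⟩
  have hconv : ConvexOn ℝ Set.univ p := by
    refine ⟨convex_univ, fun x _ y _ s t hs ht _ => ciSup_le fun a => ?_⟩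
    have h1 := mul_le_mul_of_nonneg_left (hle a a.2 x) hs
    have h2 := mul_le_mul_of_nonneg_left (hle a a.2 y) ht
    simp only [map_add, map_smul, smul_eq_mul]
    linarith
  have hlip : LipschitzWith ⟨r, hr⟩ p := by
    refine LipschitzWith.of_le_add_mul _ fun x y => ciSup_le fun a => ?_
    have h1 := hle a a.2 y
    have h2 := hbound a a.2 (x - y)
    rw [map_sub, ← dist_eq_norm] at h2
    change _ ≤ p y + r * dist x y
    linarith
  obtain ⟨x, L, hL⟩ := hX p hconv hlip.continuous
  rw [hasFDerivAt_iff_isLittleO_nhds_zero] at hL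
  obtain ⟨δ, hδ, hball⟩ := Metric.eventually_nhds_iff.1 (hL.def (half_pos hε))
  have hδ2 : 0 < δ / 2 := half_pos hδ
  -- On the sphere `‖h‖ = δ / 2`, the differentiability error and the depth of the slice each
  -- contribute `ε / 2 * (δ / 2)`, so `(a - L) h ≤ ε * ‖h‖`; homogeneity does the rest.
  refine ⟨x, p x - ε / 2 * (δ / 2), L, ?_, fun a ha hax => ?_⟩
  · obtain ⟨a, ha⟩ := exists_lt_of_lt_ciSup
      (show p x - ε / 2 * (δ / 2) < ⨆ a : A, (a : StrongDual ℝ X) x from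
        sub_lt_self _ (by positivity))
    exact ⟨a, a.2, ha⟩
  · have key : ∀ h : X, ‖h‖ = δ / 2 → (a - L) h ≤ ε * ‖h‖ := fun h hh => by
      have h1 := hball (y := h) (by rw [dist_zero_right, hh]; linarith)
      rw [hh, Real.norm_eq_abs] at h1
      have h2 := (abs_le.1 h1).2
      have h3 := hle a ha (x + h)
      rw [map_add] at h3
      rw [sub_apply, hh]
      linarith
    have key' : ∀ h : X, (a - L) h ≤ ε * ‖h‖ := fun h => by
      rcases eq_or_ne h 0 with rfl | hne
      · simp
      have hn : 0 < ‖h‖ := norm_pos_iff.2 hne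
      have ht : 0 < δ / 2 / ‖h‖ := by positivity
      have := key ((δ / 2 / ‖h‖) • h) (by
        rw [norm_smul, Real.norm_of_nonneg ht.le, div_mul_cancel₀ _ hn.ne'])
      rw [map_smul, norm_smul, Real.norm_of_nonneg ht.le, smul_eq_mul, mul_left_comm] at this
      exact le_of_mul_le_mul_left this ht
    refine ContinuousLinearMap.opNorm_le_bound _ hε.le fun h => ?_
    rw [Real.norm_eq_abs, abs_le']
    refine ⟨key' h, ?_⟩
    have := key' (-h)
    rwa [map_neg, norm_neg] at this

-- Transfinite exhaustion and countable-valued selectors.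

universe u v

/-- Transfinite exhaustion of a set: if every nonempty subset `A` of `K` is met by some `W j`
with `P A j`, then `K` is covered by such sets, each taken relative to what is left of `K`. -/
theorem exists_ordinal_exhaustion {α : Type u} {J : Type v} [Nonempty J] (K : Set α)
    (W : J → Set α) (P : Set α → J → Prop)
    (h : ∀ A ⊆ K, A.Nonempty → ∃ j, (A ∩ W j).Nonempty ∧ P A j) :
    ∃ F : Ordinal.{u} → J, K ⊆ ⋃ i, W (F i) ∧
      ∀ i, (K \ ⋃ k < i, W (F k)).Nonempty → P (K \ ⋃ k < i, W (F k)) (F i) := by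
  choose! g hg using h
  obtain ⟨F, hF⟩ : ∃ F : Ordinal.{u} → J, ∀ i, F i = g (K \ ⋃ k < i, W (F k)) := by
    let step : (i : Ordinal.{u}) → ((k : Ordinal.{u}) → k < i → J) → J :=
      fun i f => g (K \ ⋃ (k) (hk : k < i), W (f k hk))
    exact ⟨WellFounded.fix Ordinal.lt_wf step, fun i => WellFounded.fix_eq _ step i⟩
  have hP : ∀ i, (K \ ⋃ k < i, W (F k)).Nonempty →
      ((K \ ⋃ k < i, W (F k)) ∩ W (F i)).Nonempty ∧ P (K \ ⋃ k < i, W (F k)) (F i) := by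
    intro i hi
    have := hg _ Set.sdiff_subset hi
    rwa [← hF i] at this
  refine ⟨F, ?_, fun i hi => (hP i hi).2⟩
  by_contra hcov
  obtain ⟨a, haK, ha⟩ := Set.not_subset.1 hcov
  have hres : ∀ i, (K \ ⋃ k < i, W (F k)).Nonempty := fun i =>
    ⟨a, haK, fun hmem => by
      obtain ⟨k, -, hk⟩ := Set.mem_iUnion₂.1 hmem
      exact ha (Set.mem_iUnion.2 ⟨k, hk⟩)⟩
  have hne : ∀ i j, i < j → (K \ ⋃ k < i, W (F k)) ≠ K \ ⋃ k < j, W (F k) := by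
    intro i j hij heq
    obtain ⟨b, hb, hbW⟩ := (hP i (hres i)).1
    rw [heq] at hb
    exact hb.2 (Set.mem_iUnion₂.2 ⟨i, hij, hbW⟩)
  -- If the process never covered `K`, the remainders would be pairwise distinct and would inject
  -- `Ordinal.{u}` into the small type `Set α`.
  refine not_injective_of_ordinal (fun i : Ordinal.{u} => K \ ⋃ k < i, W (F k)) fun i j hij => ?_
  rcases lt_trichotomy i j with h | h | h
  · exact (hne i j h hij).elim
  · exact h
  · exact (hne j i h hij.symm).elim

/-- For open sets `U i` of a pseudometrizable space, indexed by a linear order, there is a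
countable-valued map with open fibres that takes at `x` the value `s i` whenever `i` is the
first index with `x ∈ U i`. -/
theorem exists_countable_selector {M : Type*} [TopologicalSpace M]
    [TopologicalSpace.PseudoMetrizableSpace M] {ι E : Type*} [LinearOrder ι] (U : ι → Set M)
    (hU : ∀ i, IsOpen (U i)) (s : ι → E) :
    ∃ Φ : M → Set E, (∀ p, (Φ p).Countable) ∧ (∀ e, IsOpen {p | e ∈ Φ p}) ∧
      ∀ x i, x ∈ U i → (∀ j < i, x ∉ U j) → s i ∈ Φ x := by
  let := TopologicalSpace.pseudoMetrizableSpacePseudoMetric M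
  -- `C m i` holds the points with first index `i` lying at depth `1 / (m + 1)` in `U i`. Points of
  -- `C m i` and `C m j`, `i < j`, are at least that far apart, so the neighbourhoods `N m i` of
  -- half that radius are disjoint for fixed `m`. Hence each `m` contributes at most one value.
  let C : ℕ → ι → Set M := fun m i =>
    {x | Metric.ball x (1 / (m + 1)) ⊆ U i ∧ ∀ j < i, x ∉ U j}
  let N : ℕ → ι → Set M := fun m i => ⋃ x ∈ C m i, Metric.ball x (1 / (m + 1) / 2)
  have hpos : ∀ m : ℕ, (0 : ℝ) < 1 / (m + 1) := fun m => by positivity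
  have hdisj : ∀ m i j p, p ∈ N m i → p ∈ N m j → ¬ i < j := by
    intro m i j p hi hj hij
    obtain ⟨x, hx, hpx⟩ := Set.mem_iUnion₂.1 hi
    obtain ⟨y, hy, hpy⟩ := Set.mem_iUnion₂.1 hj
    refine hy.2 i hij (hx.1 ?_)
    rw [Metric.mem_ball] at *
    have := dist_triangle_left y x p
    linarith
  refine ⟨fun p => ⋃ m, s '' {i | p ∈ N m i}, fun p => Set.countable_iUnion fun m => ?_,
    fun e => ?_, fun x i hx hj => ?_⟩
  · refine (Set.Subsingleton.countable ?_).image s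
    intro i hi j hj
    exact le_antisymm (not_lt.1 (hdisj m j i p hj hi)) (not_lt.1 (hdisj m i j p hi hj))
  · have : {p | e ∈ ⋃ m, s '' {i | p ∈ N m i}} = ⋃ (m) (i) (_ : s i = e), N m i := by
      ext p
      simp only [Set.mem_ofPred_eq, Set.mem_iUnion, Set.mem_image, exists_prop]
      exact exists_congr fun m => exists_congr fun i => and_comm
    rw [this]
    exact isOpen_iUnion fun m => isOpen_iUnion fun i => isOpen_iUnion fun _ =>
      isOpen_biUnion fun x _ => Metric.isOpen_ball
  · obtain ⟨δ, hδ, hball⟩ := Metric.isOpen_iff.1 (hU i) x hx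
    obtain ⟨m, hm⟩ := exists_nat_one_div_lt hδ
    exact Set.mem_iUnion.2 ⟨m, i, Set.mem_iUnion₂.2 ⟨x,
      ⟨(Metric.ball_subset_ball hm.le).trans hball, hj⟩,
      Metric.mem_ball_self (half_pos (hpos m))⟩, rfl⟩

/-! ### Weak* compact sets of functionals with prescribed values. -/

/-- Evaluation is jointly continuous on norm-bounded sets of the weak* dual. -/
theorem continuous_eval_of_bounded {X : Type*} [NormedAddCommGroup X] [NormedSpace ℝ X]
    {K : Set (WeakDual ℝ X)} {r : ℝ} (hK : ∀ a ∈ K, ‖WeakDual.toStrongDual a‖ ≤ r) :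
    Continuous fun q : X × K => (q.2 : WeakDual ℝ X) q.1 := by
  rw [continuous_iff_continuousAt]
  rintro ⟨x, a⟩
  have h1 : Tendsto (fun q : X × K => (q.2 : WeakDual ℝ X) (q.1 - x)) (𝓝 (x, a)) (𝓝 0) := by
    refine squeeze_zero_norm (a := fun q : X × K => r * ‖q.1 - x‖) (fun q => ?_) ?_
    · exact ((WeakDual.toStrongDual (q.2 : WeakDual ℝ X)).le_opNorm (q.1 - x)).trans
        (mul_le_mul_of_nonneg_right (hK _ q.2.2) (norm_nonneg _))
    · have : Continuous fun q : X × K => r * ‖q.1 - x‖ := by fun_prop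
      simpa using this.tendsto (x, a)
  have h2 : Tendsto (fun q : X × K => (q.2 : WeakDual ℝ X) x) (𝓝 (x, a))
      (𝓝 ((a : WeakDual ℝ X) x)) :=
    ((WeakDual.eval_continuous x).comp (continuous_subtype_val.comp continuous_snd)).tendsto (x, a)
  have h3 := h1.add h2
  rw [zero_add] at h3
  refine h3.congr fun q => ?_
  rw [map_sub, sub_add_cancel]

/-- The elements of the dual unit ball that take the prescribed values `(p i).2` at the
points `(p i).1`. -/
def prescribedBall {X : Type*} [NormedAddCommGroup X] [NormedSpace ℝ X] (p : ℕ → X × ℝ) :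
    Set (WeakDual ℝ X) :=
  {a | ‖WeakDual.toStrongDual a‖ ≤ 1 ∧ ∀ i, a (p i).1 = (p i).2}

theorem isCompact_unitBall (X : Type*) [NormedAddCommGroup X] [NormedSpace ℝ X] :
    IsCompact {a : WeakDual ℝ X | ‖WeakDual.toStrongDual a‖ ≤ 1} := by
  have := WeakDual.isCompact_closedBall (𝕜 := ℝ) (E := X) 0 1
  convert this using 1
  ext a
  simp

theorem isCompact_prescribedBall {X : Type*} [NormedAddCommGroup X] [NormedSpace ℝ X]
    (p : ℕ → X × ℝ) : IsCompact (prescribedBall p) := by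
  refine (isCompact_unitBall X).inter_right (t := {a | ∀ i, a (p i).1 = (p i).2}) ?_
  simp only [Set.ofPred_forall]
  exact isClosed_iInter fun i => isClosed_eq (WeakDual.eval_continuous _) continuous_const

/-- The set-valued map `prescribedBall` is upper semicontinuous for the weak* topology. -/
theorem isOpen_prescribedBall_subset {X : Type*} [NormedAddCommGroup X] [NormedSpace ℝ X]
    {O : Set (WeakDual ℝ X)} (hO : IsOpen O) :
    IsOpen {p : ℕ → X × ℝ | prescribedBall p ⊆ O} := by
  let K : Set (WeakDual ℝ X) := {a | ‖WeakDual.toStrongDual a‖ ≤ 1} \ O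
  have hK : IsCompact K := (isCompact_unitBall X).diff hO
  have : CompactSpace K := isCompact_iff_compactSpace.1 hK
  have hev := continuous_eval_of_bounded (K := K) (r := 1) fun a ha => ha.1
  have hcl : IsClosed {q : (ℕ → X × ℝ) × K |
      ∀ i, (q.2 : WeakDual ℝ X) (q.1 i).1 = (q.1 i).2} := by
    simp only [Set.ofPred_forall]
    refine isClosed_iInter fun i => isClosed_eq ?_ (by fun_prop)
    exact hev.comp (f := fun q : (ℕ → X × ℝ) × K => ((q.1 i).1, q.2)) (by fun_prop)
  -- The complement of the set in question is the projection of a closed set along the compact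
  -- factor `K`.
  have := isClosedMap_fst_of_compactSpace _ hcl
  rw [← isOpen_compl_iff] at this
  convert this using 1
  ext p
  simp only [Set.mem_ofPred_eq, Set.mem_compl_iff, Set.mem_image, Prod.exists, exists_and_right,
    exists_eq_right, not_exists]
  constructor
  · rintro h ⟨a, ha1, ha2⟩ hp
    exact ha2 (h ⟨ha1, hp⟩)
  · intro h a ha
    by_contra hO
    exact h ⟨a, ha.1, hO⟩ ha.2

/-! ### The selector on sequences of prescribed values. -/

/-- A countable-valued map with open fibres that takes, at every sequence of prescribed values,
a value near to some functional attaining them, and whose values near a given functional are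
determined by suitable sequences of points. -/
theorem IsAsplund.exists_near_selector {X : Type*} [NormedAddCommGroup X] [NormedSpace ℝ X]
    (hX : IsAsplund X) {ε : ℝ} (hε : 0 < ε) :
    ∃ Φ : (ℕ → X × ℝ) → Set (StrongDual ℝ X),
      (∀ p, (Φ p).Countable) ∧ (∀ e, IsOpen {p | e ∈ Φ p}) ∧
      (∀ p, (prescribedBall p).Nonempty →
        ∃ e ∈ Φ p, ∃ a ∈ prescribedBall p, ‖WeakDual.toStrongDual a - e‖ ≤ ε) ∧
      ∀ a : StrongDual ℝ X, ‖a‖ ≤ 1 → ∃ x : ℕ → X, ∃ e ∈ Φ fun i => (x i, a (x i)),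
        ‖a - e‖ ≤ ε := by
  let K : Set (WeakDual ℝ X) := {a | ‖WeakDual.toStrongDual a‖ ≤ 1}
  let W : X × ℝ × StrongDual ℝ X → Set (WeakDual ℝ X) := fun j => {a | j.2.1 < a j.1}
  obtain ⟨F, hcov, hF⟩ := exists_ordinal_exhaustion K W
    (fun A j => ∀ a ∈ A, a ∈ W j → ‖WeakDual.toStrongDual a - j.2.2‖ ≤ ε) (by
      rintro A hA ⟨a₀, ha₀⟩
      obtain ⟨x, c, L, ⟨a, ha, hax⟩, h⟩ := hX.exists_small_slice
        (A := WeakDual.toStrongDual '' A) ⟨_, a₀, ha₀, rfl⟩ (r := 1)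
        (by rintro _ ⟨a, ha, rfl⟩; exact hA ha) hε
      obtain ⟨a, ha, rfl⟩ := ha
      exact ⟨(x, c, L), ⟨a, ha, hax⟩, fun b hb hbx => h _ ⟨b, hb, rfl⟩ hbx⟩)
  have hWo : ∀ j, IsOpen (W j) := fun j =>
    isOpen_lt continuous_const (WeakDual.eval_continuous j.1)
  have hnear : ∀ i, ∀ a ∈ K, a ∈ W (F i) → (∀ k < i, a ∉ W (F k)) →
      ‖WeakDual.toStrongDual a - (F i).2.2‖ ≤ ε := by
    intro i a haK haW hk
    have : a ∈ K \ ⋃ k < i, W (F k) :=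
      ⟨haK, fun h => by obtain ⟨k, hki, hak⟩ := Set.mem_iUnion₂.1 h; exact hk k hki hak⟩
    exact hF i ⟨a, this⟩ a this haW
  obtain ⟨Φ, hc, ho, hΦ⟩ := exists_countable_selector
    (fun i => {p : ℕ → X × ℝ | prescribedBall p ⊆ ⋃ k ≤ i, W (F k)})
    (fun i => isOpen_prescribedBall_subset (isOpen_biUnion fun k _ => hWo _))
    (fun i => (F i).2.2)
  refine ⟨Φ, hc, ho, fun p hp => ?_, fun a ha => ?_⟩
  · have hfin : ∀ S : Set Ordinal, prescribedBall p ⊆ ⋃ k ∈ S, W (F k) →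
        ∃ m ∈ S, prescribedBall p ⊆ ⋃ k ≤ m, W (F k) := by
      intro S hS
      obtain ⟨t, htS, htf, ht⟩ :=
        (isCompact_prescribedBall p).elim_finite_subcover_image (fun k _ => hWo (F k)) hS
      have htne : t.Nonempty := by
        obtain ⟨b, hb⟩ := hp
        obtain ⟨k, hk, -⟩ := Set.mem_iUnion₂.1 (ht hb)
        exact ⟨k, hk⟩
      obtain ⟨m, hm, hmax⟩ := Set.exists_max_image t id htf htne
      refine ⟨m, htS hm, ht.trans ?_⟩
      exact Set.iUnion₂_mono' fun k hk => ⟨k, hmax k hk, subset_rfl⟩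
    obtain ⟨m₀, -, hm₀⟩ := hfin Set.univ fun b hb => by
      simpa using hcov hb.1
    obtain ⟨i, hi, hmin⟩ := WellFounded.has_min Ordinal.lt_wf
      {m | prescribedBall p ⊆ ⋃ k ≤ m, W (F k)} ⟨m₀, hm₀⟩
    -- By compactness a cover by the stages before `i` would stop at some stage `m < i`, against
    -- minimality. So some element is first met exactly at stage `i`.
    obtain ⟨b, hb, hbn⟩ : ∃ b ∈ prescribedBall p, b ∉ ⋃ k < i, W (F k) := by
      by_contra! hcon
      obtain ⟨m, hmi, hm⟩ := hfin (Set.Iio i) hcon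
      exact hmin m hm hmi
    refine ⟨_, hΦ p i hi fun j hj hpj => hmin j hpj hj, b, hb, ?_⟩
    have hbn' : ∀ k < i, b ∉ W (F k) := fun k hk hbk => hbn (Set.mem_iUnion₂.2 ⟨k, hk, hbk⟩)
    obtain ⟨k, hki, hbk⟩ := Set.mem_iUnion₂.1 (hi hb)
    obtain rfl : k = i := by
      by_contra hne
      exact hbn' k (lt_of_le_of_ne hki hne) hbk
    exact hnear k b hb.1 hbk hbn'
  · have haK : StrongDual.toWeakDual a ∈ K := ha
    have hex : {i | StrongDual.toWeakDual a ∈ W (F i)}.Nonempty := Set.mem_iUnion.1 (hcov haK)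
    obtain ⟨i, hi, hmin⟩ := WellFounded.has_min Ordinal.lt_wf _ hex
    have hmin' : ∀ k < i, StrongDual.toWeakDual a ∉ W (F k) := fun k hk h => hmin k h hk
    -- Agreement with `a` at all points singles out `a`, which stage `i` covers; by compactness,
    -- agreement at finitely many points already forces coverage by stage `i`.
    obtain ⟨t, ht⟩ := ((isCompact_unitBall X).diff
        (isOpen_biUnion (s := Set.Iic i) fun k _ => hWo (F k))).elim_finite_subfamily_closed
      (fun x : X => {b | b x = a x})
      (fun x => isClosed_eq (WeakDual.eval_continuous x) continuous_const) (by
        refine Set.eq_empty_iff_forall_notMem.2 fun b hb => hb.1.2 ?_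
        obtain rfl : b = StrongDual.toWeakDual a :=
          DFunLike.ext _ _ fun x => Set.mem_iInter.1 hb.2 x
        exact Set.mem_iUnion₂.2 ⟨i, le_refl i, hi⟩)
    -- Inserting `0` makes the set nonempty, so that it can be enumerated by a sequence.
    obtain ⟨x, hx⟩ := (t.countable_toSet.insert 0).exists_eq_range (Set.insert_nonempty _ _)
    refine ⟨x, _, hΦ _ i ?_ ?_, hnear i _ haK hi hmin'⟩
    · intro b hb
      by_contra hbn
      have : b ∈ (∅ : Set (WeakDual ℝ X)) := by
        rw [← ht]
        refine ⟨⟨hb.1, hbn⟩, Set.mem_iInter₂.2 fun y hy => ?_⟩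
        obtain ⟨n, rfl⟩ : y ∈ Set.range x := hx ▸ Set.mem_insert_of_mem _ hy
        exact hb.2 n
      exact this
    · intro j hj hsub
      obtain ⟨k, hkj, hk⟩ := Set.mem_iUnion₂.1
        (hsub (show StrongDual.toWeakDual a ∈ prescribedBall _ from ⟨ha, fun _ => rfl⟩))
      exact hmin' k (hkj.trans_lt hj) hk

/-! ### The assignment of dual subspaces. -/

/-- Sequences of prescribed values at points of `V`. -/
def sequencesIn {X : Type*} [NormedAddCommGroup X] [NormedSpace ℝ X] (V : Submodule ℝ X) :
    Set (ℕ → X × ℝ) :=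
  {p | ∀ i, (p i).1 ∈ V}

theorem isSeparable_sequencesIn {X : Type*} [NormedAddCommGroup X] [NormedSpace ℝ X]
    {V : Submodule ℝ X} (hV : TopologicalSpace.IsSeparable (V : Set X)) :
    TopologicalSpace.IsSeparable (sequencesIn V) := by
  refine (TopologicalSpace.IsSeparable.univ_pi (ι := ℕ)
    (s := fun _ => (V : Set X) ×ˢ (Set.univ : Set ℝ))
    fun _ => hV.prod (.of_separableSpace _)).mono fun p hp i _ => ⟨hp i, Set.mem_univ _⟩

/-- A basic neighbourhood in the product restricts finitely many coordinates; these are approximated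
inside a single `V n`, and the others are set to zero. -/
theorem sequencesIn_topologicalClosure_subset {X : Type*} [NormedAddCommGroup X]
    [NormedSpace ℝ X] {V : ℕ → Submodule ℝ X} (hV : Monotone V) :
    sequencesIn (⨆ n, V n).topologicalClosure ⊆ closure (⋃ n, sequencesIn (V n)) := by
  intro p hp
  refine mem_closure_iff.2 fun O hO hpO => ?_
  obtain ⟨I, u, hu, hsub⟩ := isOpen_pi_iff.1 hO p hpO
  have hq : ∀ i, ∃ q : X × ℝ, ∃ n, (i ∈ I → q ∈ u i) ∧ q.1 ∈ V n := by
    intro i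
    by_cases hi : i ∈ I
    · have h1 : p i ∈ closure (((⨆ n, V n : Submodule ℝ X) : Set X) ×ˢ (Set.univ : Set ℝ)) := by
        rw [closure_prod_eq]
        exact ⟨hp i, subset_closure (Set.mem_univ _)⟩
      obtain ⟨q, hqu, hqV⟩ := mem_closure_iff.1 h1 (u i) (hu i hi).1 (hu i hi).2
      obtain ⟨n, hn⟩ := (Submodule.mem_iSup_of_directed V hV.directed_le).1 hqV.1
      exact ⟨q, n, fun _ => hqu, hn⟩
    · exact ⟨0, 0, fun h => (hi h).elim, (V 0).zero_mem⟩
  choose q n hqu hqV using hq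
  classical
  refine ⟨fun i => if i ∈ I then q i else 0, hsub fun i hi => ?_,
    Set.mem_iUnion.2 ⟨I.sup n, fun i => ?_⟩⟩
  · simpa [Finset.mem_coe.1 hi] using hqu i hi
  · by_cases hi : i ∈ I
    · simpa [hi] using hV (Finset.le_sup hi) (hqV i)
    · simp [hi]

/-- In an Asplund space, one can assign to every subspace `V` a closed subspace `Y V` of the dual,
monotonically and compatibly with countable increasing unions, so that `Y V` is separable and
its restriction to `V` is dense in `V*` if `V` is separable, and such that every functional lies
in `Y V` as soon as `V` contains a suitable countable set. -/
theorem IsAsplund.exists_dual_assignment {X : Type*} [NormedAddCommGroup X] [NormedSpace ℝ X]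
    (hX : IsAsplund X) :
    ∃ Y : Submodule ℝ X → Submodule ℝ (StrongDual ℝ X),
      Monotone Y ∧ (∀ V, IsClosed (Y V : Set (StrongDual ℝ X))) ∧
      (∀ V : Submodule ℝ X, TopologicalSpace.IsSeparable (V : Set X) →
        TopologicalSpace.IsSeparable (Y V : Set (StrongDual ℝ X))) ∧
      (∀ V : ℕ → Submodule ℝ X, Monotone V →
        Y (⨆ n, V n).topologicalClosure ≤ (⨆ n, Y (V n)).topologicalClosure) ∧
      (∀ V : Submodule ℝ X, TopologicalSpace.IsSeparable (V : Set X) →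
        ∀ f : StrongDual ℝ V, ∀ ε > 0, ∃ y ∈ Y V, ‖restrictFunctional V y - f‖ ≤ ε) ∧
      ∀ x' : StrongDual ℝ X, ∃ S : Set X, S.Countable ∧
        ∀ V : Submodule ℝ X, S ⊆ V → x' ∈ Y V := by
  choose Φ hc ho hext hmem using fun k : ℕ =>
    hX.exists_near_selector (ε := 1 / ((k : ℝ) + 1)) (by positivity)
  let G : Submodule ℝ X → Set (StrongDual ℝ X) := fun V => ⋃ p ∈ sequencesIn V, ⋃ k, Φ k p
  -- Open fibres: a value taken at a limit of points of `D` is taken at a point of `D`. Both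
  -- separability and compatibility with unions come from this.
  have hG : ∀ {V : Submodule ℝ X} {D : Set (ℕ → X × ℝ)}, sequencesIn V ⊆ closure D →
      G V ⊆ ⋃ p ∈ D, ⋃ k, Φ k p := by
    intro V D hD e he
    obtain ⟨p, hp, hep⟩ := Set.mem_iUnion₂.1 he
    obtain ⟨k, hk⟩ := Set.mem_iUnion.1 hep
    obtain ⟨q, hq, hqD⟩ := mem_closure_iff.1 (hD hp) _ (ho k e) hk
    exact Set.mem_iUnion₂.2 ⟨q, hqD, Set.mem_iUnion.2 ⟨k, hq⟩⟩
  have hGmono : Monotone G := fun V V' h => Set.biUnion_subset_biUnion_left fun p hp i => h (hp i)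
  have hGY : ∀ V, G V ⊆ (Submodule.span ℝ (G V)).topologicalClosure := fun V =>
    Submodule.subset_span.trans (Submodule.le_topologicalClosure _)
  have hGmem : ∀ {V : Submodule ℝ X} {p : ℕ → X × ℝ} {k : ℕ} {e : StrongDual ℝ X},
      (∀ i, (p i).1 ∈ V) → e ∈ Φ k p → e ∈ G V := fun hp he =>
    Set.mem_iUnion₂.2 ⟨_, hp, Set.mem_iUnion.2 ⟨_, he⟩⟩
  refine ⟨fun V => (Submodule.span ℝ (G V)).topologicalClosure,
    fun V V' h => Submodule.topologicalClosure_mono (Submodule.span_mono (hGmono h)),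
    fun V => Submodule.isClosed_topologicalClosure _, fun V hV => ?_, fun V hV => ?_,
    fun V hV f ε hε => ?_, fun x' => ?_⟩
  · obtain ⟨D, hDc, hD⟩ := isSeparable_sequencesIn hV
    have : (G V).Countable := (hDc.biUnion fun p _ => Set.countable_iUnion fun k => hc k p).mono
      (hG hD)
    rw [Submodule.topologicalClosure_coe]
    exact this.isSeparable.span.closure
  · refine Submodule.topologicalClosure_minimal _ (Submodule.span_le.2 ?_)
      (Submodule.isClosed_topologicalClosure _)
    refine (hG (sequencesIn_topologicalClosure_subset hV)).trans fun e he => ?_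
    obtain ⟨p, hp, hep⟩ := Set.mem_iUnion₂.1 he
    obtain ⟨k, hk⟩ := Set.mem_iUnion.1 hep
    obtain ⟨n, hn⟩ := Set.mem_iUnion.1 hp
    exact Submodule.le_topologicalClosure _ (Submodule.mem_iSup_of_mem n (hGY _ (hGmem hn hk)))
  · obtain ⟨g, hgf, hgn⟩ := exists_extension_norm_eq V f
    have hr : 0 < ‖g‖ + 1 := by positivity
    have hg1 : ‖(‖g‖ + 1)⁻¹ • g‖ ≤ 1 := by
      rw [norm_smul, norm_inv, Real.norm_of_nonneg hr.le, inv_mul_le_one₀ hr]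
      linarith
    obtain ⟨k, hk⟩ := exists_nat_one_div_lt (div_pos hε hr)
    have : TopologicalSpace.SeparableSpace V := hV.separableSpace
    -- Prescribing values on a dense sequence of `V` forces every element of `prescribedBall p` to
    -- agree on `V` with the scaled extension of `f`. The summand `1` in the scaling factor avoids
    -- division by zero.
    let x : ℕ → V := TopologicalSpace.denseSeq V
    let p : ℕ → X × ℝ := fun i => (x i, ((‖g‖ + 1)⁻¹ • g) (x i))
    obtain ⟨e, he, a, ha, hae⟩ := hext k p
      ⟨StrongDual.toWeakDual ((‖g‖ + 1)⁻¹ • g), hg1, fun i => rfl⟩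
    have hav : ∀ v : V, WeakDual.toStrongDual a v = ((‖g‖ + 1)⁻¹ • g) v := by
      refine congrFun (Continuous.ext_on (TopologicalSpace.denseRange_denseSeq V)
        ((WeakDual.toStrongDual a).continuous.comp continuous_subtype_val)
        (((‖g‖ + 1)⁻¹ • g).continuous.comp continuous_subtype_val) ?_)
      rintro _ ⟨i, rfl⟩
      exact ha.2 i
    refine ⟨(‖g‖ + 1) • e, Submodule.smul_mem _ _ (hGY _ (hGmem (fun i => (x i).2) he)), ?_⟩
    have heq : restrictFunctional V ((‖g‖ + 1) • e) - f =
        restrictFunctional V ((‖g‖ + 1) • (e - WeakDual.toStrongDual a)) := by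
      ext v
      have h1 := hav v
      have h2 := hgf v
      simp only [restrictFunctional, sub_apply, ContinuousLinearMap.comp_apply,
        Submodule.subtypeL_apply, smul_apply, smul_eq_mul] at h1 h2 ⊢
      rw [h1, ← h2]
      field_simp
    rw [heq]
    refine ContinuousLinearMap.opNorm_le_bound _ hε.le fun v => ?_
    refine (ContinuousLinearMap.le_opNorm ((‖g‖ + 1) • (e - WeakDual.toStrongDual a)) (v : X)).trans
      (mul_le_mul_of_nonneg_right ?_ (norm_nonneg _))
    rw [norm_smul, Real.norm_of_nonneg hr.le, norm_sub_rev]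
    have := hae.trans hk.le
    rwa [le_div_iff₀' hr] at this
  · have hr : 0 < ‖x'‖ + 1 := by positivity
    have hx1 : ‖(‖x'‖ + 1)⁻¹ • x'‖ ≤ 1 := by
      rw [norm_smul, norm_inv, Real.norm_of_nonneg hr.le, inv_mul_le_one₀ hr]
      linarith
    choose x e he hxe using fun k => hmem k _ hx1
    refine ⟨⋃ k, Set.range (x k), Set.countable_iUnion fun k => Set.countable_range _,
      fun V hV => ?_⟩
    have : (‖x'‖ + 1)⁻¹ • x' ∈ (Submodule.span ℝ (G V)).topologicalClosure := by
      refine Metric.mem_closure_iff.2 fun ε hε => ?_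
      obtain ⟨k, hk⟩ := exists_nat_one_div_lt hε
      refine ⟨e k, Submodule.subset_span (hGmem (fun i => hV (Set.mem_iUnion.2 ⟨k, i, rfl⟩))
        (he k)), ?_⟩
      rw [dist_eq_norm]
      exact (hxe k).trans_lt hk
    have := Submodule.smul_mem _ (‖x'‖ + 1) this
    rwa [smul_inv_smul₀ hr.ne'] at this

/-! ### Suprema of sequences of separable subspaces and of blocks. -/

namespace SepSubspace

variable {E : Type*} [NormedAddCommGroup E] [NormedSpace ℝ E]

/-- The closed linear span of a separable set. -/
noncomputable def closedSpan (S : Set E) (hS : TopologicalSpace.IsSeparable S) : SepSubspace E :=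
  ⟨(Submodule.span ℝ S).topologicalClosure, Submodule.isClosed_topologicalClosure _, by
    rw [Submodule.topologicalClosure_coe]
    exact hS.span.closure⟩

theorem subset_closedSpan (S : Set E) (hS : TopologicalSpace.IsSeparable S) :
    S ⊆ (closedSpan S hS).1 :=
  Submodule.subset_span.trans (Submodule.le_topologicalClosure _)

/-- The supremum of a sequence of separable closed subspaces. -/
noncomputable def seqSup (V : ℕ → SepSubspace E) : SepSubspace E :=
  closedSpan (⋃ n, ((V n).1 : Set E)) (.iUnion fun n => (V n).2.2)

theorem coe_seqSup (V : ℕ → SepSubspace E) :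
    (seqSup V).1 = (⨆ n, (V n).1).topologicalClosure := by
  simp [seqSup, closedSpan, Submodule.span_iUnion]

theorem le_seqSup (V : ℕ → SepSubspace E) (n : ℕ) : V n ≤ seqSup V :=
  (Set.subset_iUnion (fun n => ((V n).1 : Set E)) n).trans (subset_closedSpan _ _)

theorem seqSup_le {V : ℕ → SepSubspace E} {W : SepSubspace E} (h : ∀ n, V n ≤ W) :
    seqSup V ≤ W :=
  Submodule.topologicalClosure_minimal _ (Submodule.span_le.2 (Set.iUnion_subset h)) W.2.1

variable {E₁ E₂ E₃ : Type*}
  [NormedAddCommGroup E₁] [NormedSpace ℝ E₁]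
  [NormedAddCommGroup E₂] [NormedSpace ℝ E₂]
  [NormedAddCommGroup E₃] [NormedSpace ℝ E₃]

/-- Allowing `W` to be no block makes `isLUB_block` a supremum among all separable closed subspaces
of the product. -/
theorem block_le_iff {U : SepSubspace E₁} {V : SepSubspace E₂} {Y : SepSubspace E₃}
    {W : SepSubspace (E₁ × E₂ × E₃)} :
    block U V Y ≤ W ↔ U.1 ≤ W.1.comap (LinearMap.inl ℝ E₁ (E₂ × E₃)) ∧
      V.1 ≤ W.1.comap (LinearMap.inr ℝ E₁ (E₂ × E₃) ∘ₗ LinearMap.inl ℝ E₂ E₃) ∧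
      Y.1 ≤ W.1.comap (LinearMap.inr ℝ E₁ (E₂ × E₃) ∘ₗ LinearMap.inr ℝ E₂ E₃) := by
  constructor
  · intro h
    refine ⟨fun u hu => h ?_, fun v hv => h ?_, fun y hy => h ?_⟩ <;> simpa [block]
  · rintro ⟨hU, hV, hY⟩ ⟨u, v, y⟩ ⟨hu, hv, hy⟩
    have := W.1.add_mem (hU hu) (W.1.add_mem (hV hv) (hY hy))
    simpa using this

theorem block_le_block_iff {U U' : SepSubspace E₁} {V V' : SepSubspace E₂}
    {Y Y' : SepSubspace E₃} : block U V Y ≤ block U' V' Y' ↔ U ≤ U' ∧ V ≤ V' ∧ Y ≤ Y' := by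
  rw [block_le_iff]
  simp [block, SetLike.le_def, ← Subtype.coe_le_coe]

theorem block_inj {U U' : SepSubspace E₁} {V V' : SepSubspace E₂} {Y Y' : SepSubspace E₃}
    (h : block U V Y = block U' V' Y') : U = U' ∧ V = V' ∧ Y = Y' := by
  obtain ⟨h1, h2, h3⟩ := block_le_block_iff.1 h.le
  obtain ⟨h1', h2', h3'⟩ := block_le_block_iff.1 h.ge
  exact ⟨h1.antisymm h1', h2.antisymm h2', h3.antisymm h3'⟩

theorem isLUB_block {U : ℕ → SepSubspace E₁} {V : ℕ → SepSubspace E₂} {Y : ℕ → SepSubspace E₃} :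
    IsLUB (Set.range fun n => block (U n) (V n) (Y n))
      (block (seqSup U) (seqSup V) (seqSup Y)) := by
  constructor
  · rintro _ ⟨n, rfl⟩
    exact block_le_block_iff.2 ⟨le_seqSup U n, le_seqSup V n, le_seqSup Y n⟩
  · intro W hW
    have h : ∀ n, _ := fun n => block_le_iff.1 (hW ⟨n, rfl⟩)
    rw [block_le_iff, coe_seqSup, coe_seqSup, coe_seqSup]
    refine ⟨Submodule.topologicalClosure_minimal _ (iSup_le fun n => (h n).1) ?_,
      Submodule.topologicalClosure_minimal _ (iSup_le fun n => (h n).2.1) ?_,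
      Submodule.topologicalClosure_minimal _ (iSup_le fun n => (h n).2.2) ?_⟩
    · exact W.2.1.preimage (f := fun u : E₁ => (u, (0 : E₂ × E₃))) (by fun_prop)
    · exact W.2.1.preimage (f := fun v : E₂ => ((0 : E₁), v, (0 : E₃))) (by fun_prop)
    · exact W.2.1.preimage (f := fun y : E₃ => ((0 : E₁), (0 : E₂), y)) (by fun_prop)

end SepSubspace

/-! ### Norming sets and isometric restriction. -/

section Restriction

variable {E : Type*} [NormedAddCommGroup E] [NormedSpace ℝ E]

theorem continuous_restrictFunctional (U : Submodule ℝ E) :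
    Continuous (restrictFunctional U) :=
  continuous_id.clm_comp continuous_const

theorem norm_restrictFunctional_le (U : Submodule ℝ E) (f : StrongDual ℝ E) :
    ‖restrictFunctional U f‖ ≤ ‖f‖ :=
  ContinuousLinearMap.opNorm_le_bound _ (norm_nonneg f) fun u => f.le_opNorm u

theorem norm_restrictFunctional_mono {U U' : Submodule ℝ E} (h : U ≤ U') (f : StrongDual ℝ E) :
    ‖restrictFunctional U f‖ ≤ ‖restrictFunctional U' f‖ :=
  ContinuousLinearMap.opNorm_le_bound _ (norm_nonneg (restrictFunctional U' f)) fun u =>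
    (restrictFunctional U' f).le_opNorm ⟨u, h u.2⟩

/-- A separable set of functionals is normed by a countable set. -/
theorem exists_countable_norming {S : Set (StrongDual ℝ E)}
    (hS : TopologicalSpace.IsSeparable S) :
    ∃ D : Set E, D.Countable ∧ ∀ U : Submodule ℝ E, D ⊆ U →
      ∀ f ∈ S, ‖restrictFunctional U f‖ = ‖f‖ := by
  obtain ⟨C, hC, hSC⟩ := hS
  choose x hx1 hx using fun (f : StrongDual ℝ E) (n : ℕ) =>
    f.exists_lt_apply_of_lt_opNorm (r := ‖f‖ - 1 / ((n : ℝ) + 1))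
      (sub_lt_self _ (by positivity))
  refine ⟨⋃ f ∈ C, Set.range (x f), hC.biUnion fun f _ => Set.countable_range _,
    fun U hU f hf => ?_⟩
  -- Norm preservation is a closed condition, so it need only be checked on the countable set `C`.
  have hcl : IsClosed {f | ‖restrictFunctional U f‖ = ‖f‖} :=
    isClosed_eq ((continuous_norm (E := StrongDual ℝ U)).comp (continuous_restrictFunctional U))
      continuous_norm
  refine closure_minimal (fun g hg => ?_) hcl (hSC hf)
  refine le_antisymm (norm_restrictFunctional_le U g) (le_of_forall_pos_lt_add fun ε hε => ?_)
  obtain ⟨n, hn⟩ := exists_nat_one_div_lt hε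
  have hmem : x g n ∈ U := hU (Set.mem_iUnion₂.2 ⟨g, hg, n, rfl⟩)
  have h1 : ‖g (x g n)‖ ≤ ‖restrictFunctional U g‖ :=
    (restrictFunctional U g).unit_le_opNorm ⟨x g n, hmem⟩ (hx1 g n).le
  linarith [hx g n]

/-- If the restriction to `V` preserves norms on a closed subspace `Y` of the dual and has dense
range, then it is an isometry of `Y` onto `V*`. -/
theorem isometry_and_surjective_restrict {V : Submodule ℝ E} {Y : Submodule ℝ (StrongDual ℝ E)}
    (hY : IsClosed (Y : Set (StrongDual ℝ E)))
    (hnorm : ∀ y ∈ Y, ‖restrictFunctional V y‖ = ‖y‖)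
    (hdense : ∀ f : StrongDual ℝ V, ∀ ε > 0, ∃ y ∈ Y, ‖restrictFunctional V y - f‖ ≤ ε) :
    Isometry (fun y : Y => restrictFunctional V (y : StrongDual ℝ E)) ∧
      Function.Surjective (fun y : Y => restrictFunctional V (y : StrongDual ℝ E)) := by
  have hiso : Isometry (fun y : Y => restrictFunctional V (y : StrongDual ℝ E)) := by
    refine Isometry.of_dist_eq fun y y' => ?_
    calc dist (restrictFunctional V y) (restrictFunctional V y')
        = ‖restrictFunctional V ((y : StrongDual ℝ E) - y')‖ :=
          dist_eq_norm (restrictFunctional V y) _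
      _ = ‖(y : StrongDual ℝ E) - y'‖ := hnorm _ (Y.sub_mem y.2 y'.2)
      _ = dist y y' := (dist_eq_norm (y : StrongDual ℝ E) y').symm
  refine ⟨hiso, fun f => ?_⟩
  have : CompleteSpace Y := hY.completeSpace_coe
  refine hiso.isClosedEmbedding.isClosed_range.closure_subset
    (Metric.mem_closure_iff.2 fun ε hε => ?_)
  obtain ⟨y, hy, hyf⟩ := hdense f (ε / 2) (half_pos hε)
  refine ⟨_, ⟨⟨y, hy⟩, rfl⟩, ?_⟩
  rw [dist_comm]
  exact ((dist_eq_norm (restrictFunctional V y) f).trans_le hyf).trans_lt (half_lt_self hε)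

end Restriction

/-! ### Reducing pairs and the rich family. -/

section RichFamily

variable {Z X : Type*} [NormedAddCommGroup Z] [NormedSpace ℝ Z]
  [NormedAddCommGroup X] [NormedSpace ℝ X]

/-- The pair `(U, V)` reduces `T` and `z'` on `Y`: `T` maps `U` into `V`, while restriction to `V`
preserves the norms on `Y`, and restriction to `U` preserves the norms of `T* y - z'` for `y`
in `Y`. -/
structure Reduces (T : Z →L[ℝ] X) (z' : StrongDual ℝ Z) (U : Submodule ℝ Z)
    (V : Submodule ℝ X) (Y : Submodule ℝ (StrongDual ℝ X)) : Prop where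
  mapsTo : Set.MapsTo T U V
  norm_eq : ∀ y ∈ Y, ‖restrictFunctional V y‖ = ‖y‖
  norm_sub_eq : ∀ y ∈ Y, ‖restrictFunctional U (adjointOp T y - z')‖ = ‖adjointOp T y - z'‖

variable {T : Z →L[ℝ] X} {z' : StrongDual ℝ Z}

theorem continuous_adjointOp (T : Z →L[ℝ] X) : Continuous (adjointOp T) :=
  continuous_id.clm_comp continuous_const

/-- All conditions pass to closures of increasing unions. Letting the stage `m` differ from `n`
serves both uses: `m = n + 1` in the saturation, `m = n` for σ-completeness. -/
theorem Reduces.seqSup {U : ℕ → SepSubspace Z} {V : ℕ → SepSubspace X}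
    {Y : ℕ → Submodule ℝ (StrongDual ℝ X)} {Y' : Submodule ℝ (StrongDual ℝ X)}
    (hY : Monotone Y) (hY' : Y' ≤ (⨆ n, Y n).topologicalClosure)
    (hT : ∀ n, ∃ m, Set.MapsTo T (U n).1 (V m).1)
    (h : ∀ n, ∃ m, ∀ y ∈ Y n, ‖restrictFunctional (V m).1 y‖ = ‖y‖ ∧
      ‖restrictFunctional (U m).1 (adjointOp T y - z')‖ = ‖adjointOp T y - z'‖) :
    Reduces T z' (SepSubspace.seqSup U).1 (SepSubspace.seqSup V).1 Y' := by
  have hclX : IsClosed {y | ‖restrictFunctional (SepSubspace.seqSup V).1 y‖ = ‖y‖} :=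
    isClosed_eq ((continuous_norm (E := StrongDual ℝ (SepSubspace.seqSup V).1)).comp
      (continuous_restrictFunctional _)) continuous_norm
  have hclZ : IsClosed {y | ‖restrictFunctional (SepSubspace.seqSup U).1 (adjointOp T y - z')‖ =
      ‖adjointOp T y - z'‖} := by
    have hsub : Continuous fun y => adjointOp T y - z' :=
      (continuous_adjointOp T).sub continuous_const
    exact isClosed_eq ((continuous_norm (E := StrongDual ℝ (SepSubspace.seqSup U).1)).comp
      ((continuous_restrictFunctional _).comp hsub)) hsub.norm
  have hmem : ∀ {y}, y ∈ Y' → y ∈ closure (⋃ n, (Y n : Set (StrongDual ℝ X))) := by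
    intro y hy
    have := hY' hy
    rwa [← SetLike.mem_coe, Submodule.topologicalClosure_coe,
      Submodule.coe_iSup_of_directed Y hY.directed_le] at this
  refine ⟨?_, fun y hy => closure_minimal (Set.iUnion_subset fun n y hy => ?_) hclX (hmem hy),
    fun y hy => closure_minimal (Set.iUnion_subset fun n y hy => ?_) hclZ (hmem hy)⟩
  · let P : SepSubspace Z → Prop := fun U' => U'.1 ≤ (SepSubspace.seqSup V).1.comap T.toLinearMap
    have hP : P (SepSubspace.seqSup U) := by
      refine Submodule.topologicalClosure_minimal _ (Submodule.span_le.2 (Set.iUnion_subset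
        fun n z hz => ?_)) ((SepSubspace.seqSup V).2.1.preimage T.continuous)
      obtain ⟨m, hm⟩ := hT n
      exact SepSubspace.le_seqSup V m (hm hz)
    exact hP
  · obtain ⟨m, hm⟩ := h n
    exact le_antisymm (norm_restrictFunctional_le _ _) ((hm y hy).1.ge.trans
      (norm_restrictFunctional_mono (SepSubspace.le_seqSup V m) y))
  · obtain ⟨m, hm⟩ := h n
    exact le_antisymm (norm_restrictFunctional_le _ _) ((hm y hy).2.ge.trans
      (norm_restrictFunctional_mono (SepSubspace.le_seqSup U m) _))

/-- Separable subspaces can be enlarged so as to reduce `T` and `z'` on a given separable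
subspace of the dual. -/
theorem exists_reducing_extension (T : Z →L[ℝ] X) (z' : StrongDual ℝ Z) (U : SepSubspace Z)
    (V : SepSubspace X) {Y : Submodule ℝ (StrongDual ℝ X)}
    (hY : TopologicalSpace.IsSeparable (Y : Set (StrongDual ℝ X))) :
    ∃ (U' : SepSubspace Z) (V' : SepSubspace X), U ≤ U' ∧ V ≤ V' ∧ Reduces T z' U'.1 V'.1 Y := by
  obtain ⟨D, hD, hDn⟩ := exists_countable_norming hY
  obtain ⟨D', hD', hDn'⟩ := exists_countable_norming (hY.image
    (f := fun y => adjointOp T y - z') ((continuous_adjointOp T).sub continuous_const))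
  let U' := SepSubspace.closedSpan (U.1 ∪ D') (U.2.2.union hD'.isSeparable)
  let V' := SepSubspace.closedSpan ((V.1 ∪ D) ∪ T '' U'.1)
    ((V.2.2.union hD.isSeparable).union (U'.2.2.image T.continuous))
  have hU' : (U.1 ∪ D' : Set Z) ⊆ U'.1 := SepSubspace.subset_closedSpan _ _
  have hV' : ((V.1 ∪ D) ∪ T '' U'.1 : Set X) ⊆ V'.1 := SepSubspace.subset_closedSpan _ _
  exact ⟨U', V', Set.subset_union_left.trans hU',
    (Set.subset_union_left.trans Set.subset_union_left).trans hV',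
    ⟨fun u hu => hV' (Or.inr ⟨u, hu, rfl⟩),
    hDn _ ((Set.subset_union_right.trans Set.subset_union_left).trans hV'),
    fun y hy => hDn' _ (Set.subset_union_right.trans hU') _ ⟨y, hy, rfl⟩⟩⟩

end RichFamily

theorem theorem2p5
    {Z : Type*} [NormedAddCommGroup Z] [NormedSpace ℝ Z] [CompleteSpace Z]
    {X : Type*} [NormedAddCommGroup X] [NormedSpace ℝ X] [CompleteSpace X]
    (hX : IsAsplund X) (T : Z →L[ℝ] X) (z' : StrongDual ℝ Z) :
    ∃ 𝒜 : Set (SepSubspace (Z × X × StrongDual ℝ X)),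
      SepSubspace.IsBlockFamily 𝒜 ∧
      IsRich 𝒜 ∧
      (∀ (U₁ U₂ : SepSubspace Z) (V₁ V₂ : SepSubspace X) (Y₁ Y₂ : SepSubspace (StrongDual ℝ X)),
        SepSubspace.block U₁ V₁ Y₁ ∈ 𝒜 → SepSubspace.block U₂ V₂ Y₂ ∈ 𝒜 →
          V₁ ≤ V₂ → Y₁ ≤ Y₂) ∧
      (∀ (U : SepSubspace Z) (V : SepSubspace X) (Y : SepSubspace (StrongDual ℝ X)),
        SepSubspace.block U V Y ∈ 𝒜 →
          Isometry (fun x' : Y.1 => restrictFunctional V.1 (x' : StrongDual ℝ X)) ∧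
          Function.Surjective (fun x' : Y.1 => restrictFunctional V.1 (x' : StrongDual ℝ X)) ∧
          ∃ hTU : Set.MapsTo T U.1 V.1,
            ∀ x' ∈ Y.1,
              ‖adjointOp T x' - z'‖ =
                ‖adjointOp (T.restrict hTU : U.1 →L[ℝ] V.1) (restrictFunctional V.1 x') -
                  restrictFunctional U.1 z'‖) := by
  obtain ⟨Y₀, hmono, hclosed, hsep, hsup, hdense, hmem⟩ := hX.exists_dual_assignment
  let Y : SepSubspace X → SepSubspace (StrongDual ℝ X) := fun V =>
    ⟨Y₀ V.1, hclosed V.1, hsep V.1 V.2.2⟩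
  have hYmono : Monotone Y := fun V V' h => hmono h
  have hYsup : ∀ V : ℕ → SepSubspace X, Monotone V →
      (Y (SepSubspace.seqSup V)).1 ≤ (⨆ n, (Y (V n)).1).topologicalClosure := by
    intro V hV
    change Y₀ (SepSubspace.seqSup V).1 ≤ _
    rw [SepSubspace.coe_seqSup]
    exact hsup _ fun m n h => hV h
  have hYseq : ∀ V : ℕ → SepSubspace X, Monotone V →
      Y (SepSubspace.seqSup V) = SepSubspace.seqSup fun n => Y (V n) := by
    intro V hV
    refine le_antisymm ?_ (SepSubspace.seqSup_le fun n => hYmono (SepSubspace.le_seqSup V n))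
    rw [← Subtype.coe_le_coe, SepSubspace.coe_seqSup]
    exact hYsup V hV
  let 𝒜 : Set (SepSubspace (Z × X × StrongDual ℝ X)) :=
    {W | ∃ U V, W = SepSubspace.block U V (Y V) ∧ Reduces T z' U.1 V.1 (Y V).1}
  have hblock : ∀ {U V Y'}, SepSubspace.block U V Y' ∈ 𝒜 →
      Y' = Y V ∧ Reduces T z' U.1 V.1 (Y V).1 := by
    rintro U V Y' ⟨U₁, V₁, heq, h⟩
    obtain ⟨rfl, rfl, rfl⟩ := SepSubspace.block_inj heq
    exact ⟨rfl, h⟩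
  refine ⟨𝒜, fun W ⟨U, V, h, _⟩ => ⟨U, V, Y V, h⟩, ⟨fun W => ?_, fun r hr hr𝒜 => ?_⟩,
    fun U₁ U₂ V₁ V₂ Y₁ Y₂ h₁ h₂ hV => ?_, fun U V Y' h => ?_⟩
  · obtain ⟨C, hC, hWC⟩ := W.2.2.image (f := fun w => w.2.2) (by fun_prop)
    -- Adding to `V₀` the sets `S c`, for `c` in a countable set whose closure contains the third
    -- projection of `W`, puts that projection inside the closed space `Y V₀`.
    choose S hSc hS using hmem
    let U₀ := SepSubspace.closedSpan ((fun w => w.1) '' (W.1 : Set (Z × X × StrongDual ℝ X)))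
      (W.2.2.image (by fun_prop))
    let V₀ := SepSubspace.closedSpan
      ((fun w => w.2.1) '' (W.1 : Set (Z × X × StrongDual ℝ X)) ∪ ⋃ c ∈ C, S c)
      ((W.2.2.image (by fun_prop)).union (hC.biUnion fun c _ => hSc c).isSeparable)
    have hV₀ := SepSubspace.subset_closedSpan
      ((fun w => w.2.1) '' (W.1 : Set (Z × X × StrongDual ℝ X)) ∪ ⋃ c ∈ C, S c)
      ((W.2.2.image (by fun_prop)).union (hC.biUnion fun c _ => hSc c).isSeparable)
    have hW : W ≤ SepSubspace.block U₀ V₀ (Y V₀) := by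
      intro w hw
      refine ⟨SepSubspace.subset_closedSpan _ _ ⟨w, hw, rfl⟩, hV₀ (Or.inl ⟨w, hw, rfl⟩), ?_⟩
      refine closure_minimal (fun c hc => ?_) (Y V₀).2.1 (hWC ⟨w, hw, rfl⟩)
      exact hS c V₀.1 ((Set.subset_biUnion_of_mem (u := S) hc).trans
        (Set.subset_union_right.trans hV₀))
    choose eU eV heU heV heR using fun a : SepSubspace Z × SepSubspace X =>
      exists_reducing_extension T z' a.1 a.2 (Y a.2).2.2
    -- Enlarging `V` also enlarges `Y V`, so one extension is not enough: stage `n + 1` reduces on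
    -- `Y` of stage `n`, and the supremum reduces on its own `Y`.
    let a : ℕ → SepSubspace Z × SepSubspace X := fun n =>
      Nat.rec (U₀, V₀) (fun _ b => (eU b, eV b)) n
    have hV : Monotone fun n => (a n).2 := monotone_nat_of_le_succ fun n => heV (a n)
    have hR : ∀ n, Reduces T z' (a (n + 1)).1.1 (a (n + 1)).2.1 (Y (a n).2).1 := fun n =>
      heR (a n)
    refine ⟨_, ⟨SepSubspace.seqSup fun n => (a n).1, SepSubspace.seqSup fun n => (a n).2, rfl,
      Reduces.seqSup (Y := fun n => (Y (a n).2).1) (fun m n h => hYmono (hV h)) (hYsup _ hV)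
        (fun n => ⟨n + 1, fun u hu => (hR n).mapsTo (heU (a n) hu)⟩)
        fun n => ⟨n + 1, fun y hy => ⟨(hR n).norm_eq y hy, (hR n).norm_sub_eq y hy⟩⟩⟩, ?_⟩
    have hV₁ : V₀ ≤ SepSubspace.seqSup fun n => (a n).2 :=
      SepSubspace.le_seqSup (fun n => (a n).2) 0
    exact hW.trans (SepSubspace.block_le_block_iff.2
      ⟨SepSubspace.le_seqSup (fun n => (a n).1) 0, hV₁, hYmono hV₁⟩)
  · choose U V hrUV hR using hr𝒜
    have hV : Monotone V := fun m n h => by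
      have := hr h
      rw [hrUV, hrUV, SepSubspace.block_le_block_iff] at this
      exact this.2.1
    refine ⟨_, ⟨SepSubspace.seqSup U, SepSubspace.seqSup V, rfl,
      Reduces.seqSup (Y := fun n => (Y (V n)).1) (fun m n h => hYmono (hV h)) (hYsup V hV)
        (fun n => ⟨n, (hR n).mapsTo⟩)
        fun n => ⟨n, fun y hy => ⟨(hR n).norm_eq y hy, (hR n).norm_sub_eq y hy⟩⟩⟩, ?_⟩
    rw [hYseq V hV, funext hrUV]
    exact SepSubspace.isLUB_block
  · rw [(hblock h₁).1, (hblock h₂).1]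
    exact hYmono hV
  · obtain ⟨rfl, hR⟩ := hblock h
    obtain ⟨hiso, hsurj⟩ := isometry_and_surjective_restrict (Y V).2.1 hR.norm_eq
      (hdense V.1 V.2.2)
    exact ⟨hiso, hsurj, hR.mapsTo, fun x' hx' => (hR.norm_sub_eq x' hx').symm⟩
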